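/- For $a,b>0$ and $x\in(0,1)$ let $$I_x(a,b)=\frac{\int_0^x t^{a-1}(1-t)^{b-1}\,dt}{\int_0^1 t^{a-1}(1-t)^{b-1}\,dt}$$ be the normalized incomplete beta function. A positive function $f$ on $(0,\infty)$ is called strictly log-convex (strictly log-concave) if $\log f$ is strictly convex (strictly concave) on $(0,\infty)$, and log-neutral if $\log f$ is both convex and concave on $(0,\infty)$. Theorem. Suppose $x\in(0,1)$ is fixed. Then: (a) if $0<b<1$, the function $a\mapsto I_x(a,b)$ is positive and strictly log-convex on $(0,\infty)$; (b) if $b=1$, then $I_x(a,1)=x^a$ for all $a>0$, and so $a\mapsto I_x(a,1)$ is log-neutral on $(0,\infty)$; (c) if $b>1$, the function $a\mapsto I_x(a,b)$ is positive and strictly log-concave on $(0,\infty)$. -/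

import Mathlib

open Set

noncomputable section

/-- The (lower) incomplete beta function `B_x(a,b) = ∫₀ˣ t^(a-1) (1-t)^(b-1) dt`. -/
def incBeta (x a b : ℝ) : ℝ :=
  ∫ t in (0 : ℝ)..x, t ^ (a - 1) * (1 - t) ^ (b - 1)

/-- The normalized incomplete beta function `I_x(a,b) = B_x(a,b) / B(a,b)`, where
`B(a,b) = B_1(a,b)` is Euler's beta integral. -/
def normIncBeta (x a b : ℝ) : ℝ :=
  incBeta x a b / incBeta 1 a b

/-- `f` is strictly log-convex on `s`: it is positive there and `log f` is strictly convex. -/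
def StrictLogConvexOn (s : Set ℝ) (f : ℝ → ℝ) : Prop :=
  (∀ a ∈ s, 0 < f a) ∧ StrictConvexOn ℝ s (fun a => Real.log (f a))

/-- `f` is strictly log-concave on `s`: it is positive there and `log f` is strictly concave. -/
def StrictLogConcaveOn (s : Set ℝ) (f : ℝ → ℝ) : Prop :=
  (∀ a ∈ s, 0 < f a) ∧ StrictConcaveOn ℝ s (fun a => Real.log (f a))

/-- `f` is log-neutral on `s`: it is positive there and `log f` is both convex and concave. -/
def LogNeutralOn (s : Set ℝ) (f : ℝ → ℝ) : Prop :=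
  (∀ a ∈ s, 0 < f a) ∧ ConvexOn ℝ s (fun a => Real.log (f a)) ∧
    ConcaveOn ℝ s (fun a => Real.log (f a))

end

open MeasureTheory ProbabilityTheory Filter Topology

noncomputable section

/-! Let `M k` be the integral of `(log t)^k w(t)` over `(0, x]`, where `w` is the beta density.
Differentiating under the integral in `a` raises `k` by one, so the second derivative of `log
I_x(a,b)` in `a` is `V(x) - V(1)`, with `V(x)` the variance of `log t` under `w` truncated to `(0,
x]`. It remains to show that `V` is strictly increasing in `x` for `b > 1` and strictly decreasing
for `b < 1`.

By `hasDerivAt_betaLogVariance`, `V'(x)` has the sign of `P₁² - M₀ P₂`, where `P₁`, `P₂` arise from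
`M₀` by iterating the primitive with respect to `dx/x`. With `θ = x d/dx`, the chain is `P₂ → P₁ →
M₀ → x w → θ(x w)`. The last ratio `θ(x w)/(x w) = a - (b-1) x/(1-x)` is strictly monotone, in a
direction fixed by the sign of `b - 1`. All terms vanish at `0`, so monotone l'Hôpital carries this
back to `x w/M₀`, then to `M₀/P₁`, and finally gives the sign of `(P₁/P₂)'`, which is that of `M₀ P₂
- P₁²`. -/

/-- The logarithmic moments `∫₀ˣ (log t)^k t^(a-1) (1-t)^(b-1) dt` of the beta density. -/
def betaLogMoment (k : ℕ) (x a b : ℝ) : ℝ :=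
  ∫ t in (0 : ℝ)..x, Real.log t ^ k * (t ^ (a - 1) * (1 - t) ^ (b - 1))

/-- The measure on `(0, x]` with density `(1-t)^(b-1)`. -/
def betaBaseMeasure (x b : ℝ) : Measure ℝ :=
  (volume.restrict (Ioc 0 x)).withDensity fun t => (((1 - t) ^ (b - 1)).toNNReal : ENNReal)

/-! ### Integrability and differentiation in `a` -/

theorem intervalIntegrable_beta {a b : ℝ} (ha : 0 < a) (hb : 0 < b) :
    IntervalIntegrable (fun t : ℝ => t ^ (a - 1) * (1 - t) ^ (b - 1)) volume 0 1 := by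
  have h := Complex.betaIntegral_convergent (u := a) (v := b) (by simpa) (by simpa)
  rw [intervalIntegrable_iff_integrableOn_Ioc_of_le zero_le_one] at h ⊢
  refine IntegrableOn.congr_fun h.re (fun t ht => ?_) measurableSet_Ioc
  have h1 : (t : ℂ) ^ ((a : ℂ) - 1) = ((t ^ (a - 1) : ℝ) : ℂ) := by
    rw [Complex.ofReal_cpow ht.1.le]; push_cast; rfl
  have h2 : (1 - (t : ℂ)) ^ ((b : ℂ) - 1) = (((1 - t) ^ (b - 1) : ℝ) : ℂ) := by
    rw [Complex.ofReal_cpow (by linarith [ht.2])]; push_cast; rfl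
  simp only [h1, h2, ← Complex.ofReal_mul]
  exact Complex.ofReal_re _

theorem measurable_betaBaseDensity (b : ℝ) :
    Measurable fun t : ℝ => ((1 - t) ^ (b - 1)).toNNReal := by fun_prop

theorem toNNReal_smul_log_pow_mul_exp {t x : ℝ} (hx : x ≤ 1) (ht : t ∈ Ioc 0 x) (k : ℕ)
    (a b : ℝ) :
    ((1 - t) ^ (b - 1)).toNNReal • (Real.log t ^ k * Real.exp ((a - 1) * Real.log t)) =
      Real.log t ^ k * (t ^ (a - 1) * (1 - t) ^ (b - 1)) := by
  rw [NNReal.smul_def, Real.coe_toNNReal _ (Real.rpow_nonneg (by linarith [ht.2]) _),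
    Real.rpow_def_of_pos ht.1, mul_comm (Real.log t) (a - 1), smul_eq_mul]
  ring

theorem integral_betaBaseMeasure {x : ℝ} (hx0 : 0 ≤ x) (hx : x ≤ 1) (k : ℕ) (a b : ℝ) :
    ∫ t, Real.log t ^ k * Real.exp ((a - 1) * Real.log t) ∂(betaBaseMeasure x b) =
      betaLogMoment k x a b := by
  rw [betaBaseMeasure, integral_withDensity_eq_integral_smul (measurable_betaBaseDensity b),
    betaLogMoment, intervalIntegral.integral_of_le hx0]
  exact setIntegral_congr_fun measurableSet_Ioc
    fun t ht => toNNReal_smul_log_pow_mul_exp hx ht k a b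

theorem integrable_betaBaseMeasure_iff {x : ℝ} (hx : x ≤ 1) (k : ℕ) (a b : ℝ) :
    Integrable (fun t => Real.log t ^ k * Real.exp ((a - 1) * Real.log t))
      (betaBaseMeasure x b) ↔
      IntegrableOn (fun t => Real.log t ^ k * (t ^ (a - 1) * (1 - t) ^ (b - 1))) (Ioc 0 x) := by
  rw [betaBaseMeasure, integrable_withDensity_iff_integrable_smul (measurable_betaBaseDensity b)]
  exact integrableOn_congr_fun
    (fun t ht => toNNReal_smul_log_pow_mul_exp hx ht k a b) measurableSet_Ioc

/-- Since `t^(a-1) = exp((a-1) log t)`, the beta integral is the moment generating function of `log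
t` at `a - 1`. Being interior to its domain gives integrability of all log moments and
differentiability in `a`. -/
theorem mem_interior_integrableExpSet_log {x a b : ℝ} (hx : x ≤ 1) (ha : 0 < a) (hb : 0 < b) :
    a - 1 ∈ interior (integrableExpSet Real.log (betaBaseMeasure x b)) := by
  refine mem_interior.2 ⟨Ioi (-1), fun c hc => ?_, isOpen_Ioi, by simpa using ha⟩
  have hc' : 0 < c + 1 := by linarith [mem_Ioi.1 hc]
  have h := (integrable_betaBaseMeasure_iff hx 0 (c + 1) b).2 (by
    have := (intervalIntegrable_iff_integrableOn_Ioc_of_le zero_le_one).1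
      (intervalIntegrable_beta hc' hb)
    simpa using this.mono_set (Ioc_subset_Ioc_right hx))
  simpa [integrableExpSet] using h

theorem intervalIntegrable_log_pow_mul_beta {a b : ℝ} (k : ℕ) (ha : 0 < a) (hb : 0 < b) :
    IntervalIntegrable (fun t : ℝ => Real.log t ^ k * (t ^ (a - 1) * (1 - t) ^ (b - 1)))
      volume 0 1 := by
  rw [intervalIntegrable_iff_integrableOn_Ioc_of_le zero_le_one,
    ← integrable_betaBaseMeasure_iff le_rfl]
  exact integrable_pow_mul_exp_of_mem_interior_integrableExpSet
    (mem_interior_integrableExpSet_log le_rfl ha hb) k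

theorem hasDerivAt_betaLogMoment_param {x a b : ℝ} (hx0 : 0 ≤ x) (hx : x ≤ 1) (k : ℕ)
    (ha : 0 < a) (hb : 0 < b) :
    HasDerivAt (fun a => betaLogMoment k x a b) (betaLogMoment (k + 1) x a b) a := by
  have h := (hasDerivAt_integral_pow_mul_exp_real
    (mem_interior_integrableExpSet_log hx ha hb) k).comp_sub_const a 1
  simpa only [integral_betaBaseMeasure hx0 hx] using h

theorem betaLogMoment_zero_pos {x a b : ℝ} (hx0 : 0 < x) (hx : x ≤ 1) (ha : 0 < a)
    (hb : 0 < b) : 0 < betaLogMoment 0 x a b := by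
  refine intervalIntegral.intervalIntegral_pos_of_pos_on ?_ (fun t ht => ?_) hx0
  · exact (intervalIntegrable_log_pow_mul_beta 0 ha hb).mono_set
      (by rw [uIcc_of_le hx0.le, uIcc_of_le zero_le_one]; exact Icc_subset_Icc_right hx)
  · have : 0 < 1 - t := by linarith [ht.2]
    have := ht.1
    positivity

/-! ### Dependence on the endpoint `x` -/

theorem continuousOn_betaLogMoment {a b : ℝ} (k : ℕ) (ha : 0 < a) (hb : 0 < b) :
    ContinuousOn (fun x => betaLogMoment k x a b) (Icc 0 1) := by
  have h := intervalIntegral.continuousOn_primitive_interval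
    ((intervalIntegrable_iff').1 (intervalIntegrable_log_pow_mul_beta k ha hb))
  rwa [uIcc_of_le zero_le_one] at h

theorem hasDerivAt_betaLogMoment {x a b : ℝ} (hx : x ∈ Ioo (0 : ℝ) 1) (k : ℕ)
    (ha : 0 < a) (hb : 0 < b) :
    HasDerivAt (fun x => betaLogMoment k x a b)
      (Real.log x ^ k * (x ^ (a - 1) * (1 - x) ^ (b - 1))) x := by
  refine intervalIntegral.integral_hasDerivAt_right ?_ ?_ ?_
  · exact (intervalIntegrable_log_pow_mul_beta k ha hb).mono_set
      (by rw [uIcc_of_le hx.1.le, uIcc_of_le zero_le_one]; exact Icc_subset_Icc_right hx.2.le)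
  · exact (by fun_prop : Measurable fun t : ℝ =>
      Real.log t ^ k * (t ^ (a - 1) * (1 - t) ^ (b - 1))).stronglyMeasurable.stronglyMeasurableAtFilter
  · have h1 : 1 - x ≠ 0 := by linarith [hx.2]
    exact ((Real.continuousAt_log hx.1.ne').pow k).mul
      ((continuousAt_id.rpow_const (Or.inl hx.1.ne')).mul
        ((continuousAt_const.sub continuousAt_id).rpow_const (Or.inl h1)))

/-- For `0 < t ≤ x < 1`, `|log x| ≤ |log t|`, so the factor `(log x)^j` can be absorbed into the
integrand; the resulting integral of an integrable function over `(0, x]` tends to `0`. -/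
theorem tendsto_log_pow_mul_betaLogMoment {a b : ℝ} (j k : ℕ) (ha : 0 < a) (hb : 0 < b) :
    Tendsto (fun x => Real.log x ^ j * betaLogMoment k x a b) (𝓝[>] 0) (𝓝 0) := by
  have hint := (intervalIntegrable_log_pow_mul_beta (j + k) ha hb).norm
  have hcont := intervalIntegral.continuousOn_primitive_interval ((intervalIntegrable_iff').1 hint)
  rw [uIcc_of_le zero_le_one] at hcont
  have hlim := ((hcont 0 (by simp)).mono_left
    (nhdsWithin_mono 0 (Ioo_subset_Icc_self (a := (0 : ℝ)) (b := 1))))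
  rw [nhdsWithin_Ioo_eq_nhdsGT zero_lt_one] at hlim
  simp only [intervalIntegral.integral_same] at hlim
  refine squeeze_zero_norm' ?_ hlim
  filter_upwards [Ioo_mem_nhdsGT (zero_lt_one (α := ℝ))] with x hx
  have hsub : uIcc 0 x ⊆ uIcc (0 : ℝ) 1 := by
    rw [uIcc_of_le hx.1.le, uIcc_of_le zero_le_one]; exact Icc_subset_Icc_right hx.2.le
  rw [betaLogMoment, ← intervalIntegral.integral_const_mul]
  refine intervalIntegral.norm_integral_le_of_norm_le hx.1.le
    (Eventually.of_forall fun t ht => ?_) (hint.mono_set hsub)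
  simp only [norm_mul, norm_pow, pow_add]
  rw [← mul_assoc]
  gcongr 1
  gcongr ?_ ^ _ * _
  have h1 := Real.log_le_log ht.1 ht.2
  have h2 := Real.log_nonpos hx.1.le hx.2.le
  rw [Real.norm_of_nonpos h2, Real.norm_of_nonpos (h1.trans h2)]
  linarith

/-! ### Monotone l'Hôpital rule at `0` -/

section MonotoneLHopital

variable {F G F' G' : ℝ → ℝ} {r : ℝ}

theorem exists_pos_and_cauchy_slope {x : ℝ}
    (hF : ∀ x ∈ Ioo 0 r, HasDerivAt F (F' x) x) (hG : ∀ x ∈ Ioo 0 r, HasDerivAt G (G' x) x)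
    (hF0 : Tendsto F (𝓝[>] 0) (𝓝 0)) (hG0 : Tendsto G (𝓝[>] 0) (𝓝 0))
    (hpos : ∀ x ∈ Ioo 0 r, 0 < G' x) (hx : x ∈ Ioo 0 r) :
    0 < G x ∧ ∃ c ∈ Ioo 0 x, G x * F' c = F x * G' c := by
  have hsub : ∀ y ∈ Ioo 0 x, y ∈ Ioo 0 r := fun y hy => ⟨hy.1, hy.2.trans hx.2⟩
  have hFx : Tendsto F (𝓝[<] x) (𝓝 (F x)) := (hF x hx).continuousAt.tendsto.mono_left inf_le_left
  have hGx : Tendsto G (𝓝[<] x) (𝓝 (G x)) := (hG x hx).continuousAt.tendsto.mono_left inf_le_left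
  constructor
  -- Cauchy's theorem against the identity is the ordinary mean value theorem, with only a limit
  -- required at `0`.
  · obtain ⟨c, hc, h⟩ := exists_ratio_hasDerivAt_eq_ratio_slope' id (fun _ => 1) hx.1 G G'
      (fun y _ => hasDerivAt_id y) (fun y hy => hG y (hsub y hy))
      (tendsto_id.mono_left inf_le_left) hG0 (tendsto_id.mono_left inf_le_left) hGx
    have := mul_pos hx.1 (hpos c (hsub c hc))
    simp only [sub_zero, mul_one] at h
    rwa [h]
  · obtain ⟨c, hc, h⟩ := exists_ratio_hasDerivAt_eq_ratio_slope' F F' hx.1 G G'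
      (fun y hy => hF y (hsub y hy)) (fun y hy => hG y (hsub y hy)) hF0 hG0 hFx hGx
    exact ⟨c, hc, by simpa using h⟩

/-- Cauchy gives `F x / G x = F' c / G' c` with `c < x`, which exceeds `F' x / G' x`. This is the
sign of `(F/G)'`, kept separate because the last link of the chain needs it pointwise. -/
theorem deriv_mul_lt_of_strictAntiOn
    (hF : ∀ x ∈ Ioo 0 r, HasDerivAt F (F' x) x) (hG : ∀ x ∈ Ioo 0 r, HasDerivAt G (G' x) x)
    (hF0 : Tendsto F (𝓝[>] 0) (𝓝 0)) (hG0 : Tendsto G (𝓝[>] 0) (𝓝 0))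
    (hpos : ∀ x ∈ Ioo 0 r, 0 < G' x) (hanti : StrictAntiOn (fun x => F' x / G' x) (Ioo 0 r))
    {x : ℝ} (hx : x ∈ Ioo 0 r) : F' x * G x < F x * G' x := by
  obtain ⟨hGx, c, hc, h⟩ := exists_pos_and_cauchy_slope hF hG hF0 hG0 hpos hx
  have hcr : c ∈ Ioo 0 r := ⟨hc.1, hc.2.trans hx.2⟩
  have h1 := hanti hcr hx hc.2
  simp only at h1
  rw [div_lt_div_iff₀ (hpos x hx) (hpos c hcr)] at h1
  refine lt_of_mul_lt_mul_right (a := G' c) ?_ (hpos c hcr).le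
  calc F' x * G x * G' c = G x * (F' x * G' c) := by ring
    _ < G x * (F' c * G' x) := mul_lt_mul_of_pos_left h1 hGx
    _ = F x * G' x * G' c := by rw [← mul_assoc, h]; ring

/-- The monotone form of l'Hôpital's rule. -/
theorem strictAntiOn_div_of_deriv
    (hF : ∀ x ∈ Ioo 0 r, HasDerivAt F (F' x) x) (hG : ∀ x ∈ Ioo 0 r, HasDerivAt G (G' x) x)
    (hF0 : Tendsto F (𝓝[>] 0) (𝓝 0)) (hG0 : Tendsto G (𝓝[>] 0) (𝓝 0))
    (hpos : ∀ x ∈ Ioo 0 r, 0 < G' x) (hanti : StrictAntiOn (fun x => F' x / G' x) (Ioo 0 r)) :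
    StrictAntiOn (fun x => F x / G x) (Ioo 0 r) := by
  have hGpos : ∀ x ∈ Ioo 0 r, 0 < G x := fun x hx =>
    (exists_pos_and_cauchy_slope hF hG hF0 hG0 hpos hx).1
  have hd : ∀ x ∈ Ioo 0 r,
      HasDerivAt (fun x => F x / G x) ((F' x * G x - F x * G' x) / G x ^ 2) x :=
    fun x hx => (hF x hx).fun_div (hG x hx) (hGpos x hx).ne'
  refine strictAntiOn_of_deriv_neg (convex_Ioo 0 r)
    (fun x hx => (hd x hx).continuousAt.continuousWithinAt) fun x hx => ?_
  rw [interior_Ioo] at hx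
  rw [(hd x hx).deriv]
  exact div_neg_of_neg_of_pos
    (by linarith [deriv_mul_lt_of_strictAntiOn hF hG hF0 hG0 hpos hanti hx])
    (pow_pos (hGpos x hx) 2)

theorem strictAntiOn_neg_div {s : Set ℝ} (h : StrictMonoOn (fun x => F x / G x) s) :
    StrictAntiOn (fun x => -F x / G x) s := fun x hx y hy hxy => by
  simpa only [neg_div, neg_lt_neg_iff] using h hx hy hxy

theorem lt_deriv_mul_of_strictMonoOn
    (hF : ∀ x ∈ Ioo 0 r, HasDerivAt F (F' x) x) (hG : ∀ x ∈ Ioo 0 r, HasDerivAt G (G' x) x)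
    (hF0 : Tendsto F (𝓝[>] 0) (𝓝 0)) (hG0 : Tendsto G (𝓝[>] 0) (𝓝 0))
    (hpos : ∀ x ∈ Ioo 0 r, 0 < G' x) (hmono : StrictMonoOn (fun x => F' x / G' x) (Ioo 0 r))
    {x : ℝ} (hx : x ∈ Ioo 0 r) : F x * G' x < F' x * G x := by
  have h := deriv_mul_lt_of_strictAntiOn (F := fun x => -F x) (F' := fun x => -F' x)
    (fun x hx => (hF x hx).fun_neg) hG (by simpa using hF0.neg) hG0 hpos
    (strictAntiOn_neg_div hmono) hx
  linarith

theorem strictMonoOn_div_of_deriv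
    (hF : ∀ x ∈ Ioo 0 r, HasDerivAt F (F' x) x) (hG : ∀ x ∈ Ioo 0 r, HasDerivAt G (G' x) x)
    (hF0 : Tendsto F (𝓝[>] 0) (𝓝 0)) (hG0 : Tendsto G (𝓝[>] 0) (𝓝 0))
    (hpos : ∀ x ∈ Ioo 0 r, 0 < G' x) (hmono : StrictMonoOn (fun x => F' x / G' x) (Ioo 0 r)) :
    StrictMonoOn (fun x => F x / G x) (Ioo 0 r) := by
  have h := strictAntiOn_div_of_deriv (F := fun x => -F x) (F' := fun x => -F' x)
    (fun x hx => (hF x hx).fun_neg) hG (by simpa using hF0.neg) hG0 hpos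
    (strictAntiOn_neg_div hmono)
  intro x hx y hy hxy
  simpa only [neg_div, neg_lt_neg_iff] using h hx hy hxy

end MonotoneLHopital

/-! ### Iterated primitives and their log-concavity or log-convexity -/

/-- The iterated logarithmic primitive `∫₀ˣ (log x - log t) t^(a-1) (1-t)^(b-1) dt`. -/
def betaLogPrimitive (a b x : ℝ) : ℝ :=
  Real.log x * betaLogMoment 0 x a b - betaLogMoment 1 x a b

/-- The iterated logarithmic primitive `∫₀ˣ (log x - log t)² / 2 t^(a-1) (1-t)^(b-1) dt`. -/
def betaLogPrimitiveTwo (a b x : ℝ) : ℝ :=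
  (Real.log x ^ 2 * betaLogMoment 0 x a b - 2 * (Real.log x * betaLogMoment 1 x a b) +
    betaLogMoment 2 x a b) / 2

section Primitives

variable {a b : ℝ}

theorem hasDerivAt_betaLogPrimitive {x : ℝ} (ha : 0 < a) (hb : 0 < b) (hx : x ∈ Ioo (0 : ℝ) 1) :
    HasDerivAt (betaLogPrimitive a b) (betaLogMoment 0 x a b / x) x := by
  refine (((Real.hasDerivAt_log hx.1.ne').mul (hasDerivAt_betaLogMoment hx 0 ha hb)).sub
    (hasDerivAt_betaLogMoment hx 1 ha hb)).congr_deriv ?_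
  ring

theorem hasDerivAt_betaLogPrimitiveTwo {x : ℝ} (ha : 0 < a) (hb : 0 < b)
    (hx : x ∈ Ioo (0 : ℝ) 1) :
    HasDerivAt (betaLogPrimitiveTwo a b) (betaLogPrimitive a b x / x) x := by
  have hL := Real.hasDerivAt_log hx.1.ne'
  refine (((((hL.fun_pow 2).mul (hasDerivAt_betaLogMoment hx 0 ha hb)).sub
    ((hL.mul (hasDerivAt_betaLogMoment hx 1 ha hb)).const_mul 2)).add
    (hasDerivAt_betaLogMoment hx 2 ha hb)).div_const 2).congr_deriv ?_
  simp only [betaLogPrimitive]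
  push_cast
  ring

theorem tendsto_betaLogMoment (k : ℕ) (ha : 0 < a) (hb : 0 < b) :
    Tendsto (fun x => betaLogMoment k x a b) (𝓝[>] 0) (𝓝 0) := by
  simpa using tendsto_log_pow_mul_betaLogMoment 0 k ha hb

theorem tendsto_betaLogPrimitive (ha : 0 < a) (hb : 0 < b) :
    Tendsto (betaLogPrimitive a b) (𝓝[>] 0) (𝓝 0) := by
  have h := (tendsto_log_pow_mul_betaLogMoment 1 0 ha hb).sub (tendsto_betaLogMoment 1 ha hb)
  simp only [pow_one, sub_zero] at h
  exact h

theorem tendsto_betaLogPrimitiveTwo (ha : 0 < a) (hb : 0 < b) :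
    Tendsto (betaLogPrimitiveTwo a b) (𝓝[>] 0) (𝓝 0) := by
  have h := (((tendsto_log_pow_mul_betaLogMoment 2 0 ha hb).sub
    ((tendsto_log_pow_mul_betaLogMoment 1 1 ha hb).const_mul 2)).add
    (tendsto_betaLogMoment 2 ha hb)).div_const 2
  simp only [pow_one, sub_zero, mul_zero, add_zero, zero_div] at h
  exact h

theorem betaLogPrimitive_pos {x : ℝ} (ha : 0 < a) (hb : 0 < b) (hx : x ∈ Ioo (0 : ℝ) 1) :
    0 < betaLogPrimitive a b x :=
  -- Only the positivity half is needed, so the same function serves as `F` and `G`.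
  (exists_pos_and_cauchy_slope (fun _ h => hasDerivAt_betaLogPrimitive ha hb h)
    (fun _ h => hasDerivAt_betaLogPrimitive ha hb h) (tendsto_betaLogPrimitive ha hb)
    (tendsto_betaLogPrimitive ha hb)
    (fun _ h => div_pos (betaLogMoment_zero_pos h.1 h.2.le ha hb) h.1) hx).1

theorem beta_density_pos {x : ℝ} (hx : x ∈ Ioo (0 : ℝ) 1) :
    0 < x ^ (a - 1) * (1 - x) ^ (b - 1) :=
  mul_pos (Real.rpow_pos_of_pos hx.1 _) (Real.rpow_pos_of_pos (by linarith [hx.2]) _)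

theorem hasDerivAt_mul_beta_density {x : ℝ} (hx : x ∈ Ioo (0 : ℝ) 1) :
    HasDerivAt (fun x : ℝ => x * (x ^ (a - 1) * (1 - x) ^ (b - 1)))
      ((a - (b - 1) * (x / (1 - x))) * (x ^ (a - 1) * (1 - x) ^ (b - 1))) x := by
  have h1 : 0 < 1 - x := by linarith [hx.2]
  have hd := (hasDerivAt_id x).mul (((hasDerivAt_id x).rpow_const (p := a - 1)
    (Or.inl hx.1.ne')).mul (((hasDerivAt_id x).const_sub 1).rpow_const (p := b - 1)
    (Or.inl h1.ne')))
  refine hd.congr_deriv ?_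
  simp only [id, Pi.mul_apply]
  rw [Real.rpow_sub_one hx.1.ne' (a - 1), Real.rpow_sub_one h1.ne' (b - 1)]
  have := hx.1.ne'
  field_simp
  ring

theorem tendsto_mul_beta_density (ha : 0 < a) :
    Tendsto (fun x : ℝ => x * (x ^ (a - 1) * (1 - x) ^ (b - 1))) (𝓝[>] 0) (𝓝 0) := by
  have h1 : ContinuousAt (fun x : ℝ => x ^ a * (1 - x) ^ (b - 1)) 0 :=
    (Real.continuousAt_rpow_const 0 a (Or.inr ha.le)).mul
      ((continuousAt_const.sub continuousAt_id).rpow_const (Or.inl (by simp)))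
  have h2 : Tendsto (fun x : ℝ => x ^ a * (1 - x) ^ (b - 1)) (𝓝[>] 0) (𝓝 0) := by
    have h := h1.continuousWithinAt (s := Ioi 0)
    simpa [ContinuousWithinAt, Real.zero_rpow ha.ne'] using h
  refine h2.congr' ?_
  filter_upwards [self_mem_nhdsWithin] with x hx
  rw [Real.rpow_sub_one (ne_of_gt hx)]
  have : x ≠ 0 := ne_of_gt hx
  field_simp

theorem div_one_sub_strictMonoOn : StrictMonoOn (fun x : ℝ => x / (1 - x)) (Ioo 0 1) := by
  intro x hx y hy hxy
  have h1 : 0 < 1 - x := by linarith [hx.2]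
  have h2 : 0 < 1 - y := by linarith [hy.2]
  simp only
  rw [div_lt_div_iff₀ h1 h2]
  linarith

theorem betaLogMoment_mul_lt_sq {x : ℝ} (ha : 0 < a) (hb : 1 < b) (hx : x ∈ Ioo (0 : ℝ) 1) :
    betaLogMoment 0 x a b * betaLogPrimitiveTwo a b x < betaLogPrimitive a b x ^ 2 := by
  have hb0 : 0 < b := by linarith
  have hM0 : ∀ x ∈ Ioo (0 : ℝ) 1, 0 < betaLogMoment 0 x a b := fun x h =>
    betaLogMoment_zero_pos h.1 h.2.le ha hb0
  have hdM0 : ∀ x ∈ Ioo (0 : ℝ) 1, HasDerivAt (fun x => betaLogMoment 0 x a b)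
      (x ^ (a - 1) * (1 - x) ^ (b - 1)) x := fun x h => by
    simpa using hasDerivAt_betaLogMoment h 0 ha hb0
  have s1 := strictAntiOn_div_of_deriv (fun x h => hasDerivAt_mul_beta_density (a := a) (b := b) h) hdM0
    (tendsto_mul_beta_density ha) (tendsto_betaLogMoment 0 ha hb0)
    (fun x h => beta_density_pos h) (fun x h y h' hxy => by
      simp only [mul_div_cancel_right₀ _ (beta_density_pos h).ne',
        mul_div_cancel_right₀ _ (beta_density_pos h').ne']
      have := mul_lt_mul_of_pos_left (div_one_sub_strictMonoOn h h' hxy) (sub_pos.2 hb)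
      simpa using this)
  -- The quotient of derivatives is `w / (M₀/x) = x w / M₀`, the ratio just treated.
  have s2 := strictAntiOn_div_of_deriv hdM0 (fun x h => hasDerivAt_betaLogPrimitive ha hb0 h)
    (tendsto_betaLogMoment 0 ha hb0) (tendsto_betaLogPrimitive ha hb0)
    (fun x h => div_pos (hM0 x h) h.1) (s1.congr fun x h => by
      have := h.1.ne'; have := (hM0 x h).ne'; field_simp)
  have s3 := deriv_mul_lt_of_strictAntiOn (fun x h => hasDerivAt_betaLogPrimitive ha hb0 h)
    (fun x h => hasDerivAt_betaLogPrimitiveTwo ha hb0 h)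
    (tendsto_betaLogPrimitive ha hb0) (tendsto_betaLogPrimitiveTwo ha hb0)
    (fun x h => div_pos (betaLogPrimitive_pos ha hb0 h) h.1) (s2.congr fun x h => by
      have := h.1.ne'; have := (betaLogPrimitive_pos ha hb0 h).ne'; field_simp) hx
  rw [div_mul_eq_mul_div, mul_div_assoc', div_lt_div_iff_of_pos_right hx.1] at s3
  rwa [sq]

theorem sq_lt_betaLogMoment_mul {x : ℝ} (ha : 0 < a) (hb0 : 0 < b) (hb : b < 1)
    (hx : x ∈ Ioo (0 : ℝ) 1) :
    betaLogPrimitive a b x ^ 2 < betaLogMoment 0 x a b * betaLogPrimitiveTwo a b x := by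
  have hM0 : ∀ x ∈ Ioo (0 : ℝ) 1, 0 < betaLogMoment 0 x a b := fun x h =>
    betaLogMoment_zero_pos h.1 h.2.le ha hb0
  have hdM0 : ∀ x ∈ Ioo (0 : ℝ) 1, HasDerivAt (fun x => betaLogMoment 0 x a b)
      (x ^ (a - 1) * (1 - x) ^ (b - 1)) x := fun x h => by
    simpa using hasDerivAt_betaLogMoment h 0 ha hb0
  have s1 := strictMonoOn_div_of_deriv (fun x h => hasDerivAt_mul_beta_density (a := a) (b := b) h) hdM0
    (tendsto_mul_beta_density ha) (tendsto_betaLogMoment 0 ha hb0)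
    (fun x h => beta_density_pos h) (fun x h y h' hxy => by
      simp only [mul_div_cancel_right₀ _ (beta_density_pos h).ne',
        mul_div_cancel_right₀ _ (beta_density_pos h').ne']
      have := mul_lt_mul_of_pos_left (div_one_sub_strictMonoOn h h' hxy) (sub_pos.2 hb)
      simp only at this
      linarith)
  have s2 := strictMonoOn_div_of_deriv hdM0 (fun x h => hasDerivAt_betaLogPrimitive ha hb0 h)
    (tendsto_betaLogMoment 0 ha hb0) (tendsto_betaLogPrimitive ha hb0)
    (fun x h => div_pos (hM0 x h) h.1) (s1.congr fun x h => by
      have := h.1.ne'; have := (hM0 x h).ne'; field_simp)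
  have s3 := lt_deriv_mul_of_strictMonoOn (fun x h => hasDerivAt_betaLogPrimitive ha hb0 h)
    (fun x h => hasDerivAt_betaLogPrimitiveTwo ha hb0 h)
    (tendsto_betaLogPrimitive ha hb0) (tendsto_betaLogPrimitiveTwo ha hb0)
    (fun x h => div_pos (betaLogPrimitive_pos ha hb0 h) h.1) (s2.congr fun x h => by
      have := h.1.ne'; have := (betaLogPrimitive_pos ha hb0 h).ne'; field_simp) hx
  rw [div_mul_eq_mul_div, mul_div_assoc', div_lt_div_iff_of_pos_right hx.1] at s3
  rwa [sq]

end Primitives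

/-! ### Monotonicity of the truncated variance -/

/-- The variance of `log t` under the beta density truncated to `(0, x]`. -/
def betaLogVariance (a b x : ℝ) : ℝ :=
  betaLogMoment 2 x a b / betaLogMoment 0 x a b -
    (betaLogMoment 1 x a b / betaLogMoment 0 x a b) ^ 2

section Variance

variable {a b : ℝ}

theorem continuousOn_betaLogVariance (ha : 0 < a) (hb : 0 < b) :
    ContinuousOn (betaLogVariance a b) (Ioc 0 1) := by
  have hc : ∀ k, ContinuousOn (fun x => betaLogMoment k x a b) (Ioc 0 1) := fun k =>
    (continuousOn_betaLogMoment k ha hb).mono Ioc_subset_Icc_self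
  have h0 : ∀ x ∈ Ioc (0 : ℝ) 1, betaLogMoment 0 x a b ≠ 0 := fun x h =>
    (betaLogMoment_zero_pos h.1 h.2 ha hb).ne'
  exact ((hc 2).div (hc 0) h0).sub (((hc 1).div (hc 0) h0).pow 2)

theorem hasDerivAt_betaLogVariance {x : ℝ} (ha : 0 < a) (hb : 0 < b) (hx : x ∈ Ioo (0 : ℝ) 1) :
    HasDerivAt (betaLogVariance a b)
      (2 * (x ^ (a - 1) * (1 - x) ^ (b - 1)) / betaLogMoment 0 x a b ^ 3 *
        (betaLogPrimitive a b x ^ 2 - betaLogMoment 0 x a b * betaLogPrimitiveTwo a b x)) x := by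
  have h0 := (betaLogMoment_zero_pos hx.1 hx.2.le ha hb).ne'
  have hd := fun k => hasDerivAt_betaLogMoment hx k ha hb
  refine (((hd 2).fun_div (hd 0) h0).sub (((hd 1).fun_div (hd 0) h0).fun_pow 2)).congr_deriv ?_
  simp only [betaLogPrimitive, betaLogPrimitiveTwo, Nat.cast_ofNat, Nat.reduceSub, pow_one]
  field_simp
  ring

theorem betaLogVariance_strictMonoOn (ha : 0 < a) (hb : 1 < b) :
    StrictMonoOn (betaLogVariance a b) (Ioc 0 1) := by
  have hb0 : 0 < b := by linarith
  refine strictMonoOn_of_deriv_pos (convex_Ioc 0 1) (continuousOn_betaLogVariance ha hb0)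
    fun x hx => ?_
  rw [interior_Ioc] at hx
  rw [(hasDerivAt_betaLogVariance ha hb0 hx).deriv]
  have h0 := betaLogMoment_zero_pos hx.1 hx.2.le ha hb0
  exact mul_pos (div_pos (mul_pos two_pos (beta_density_pos hx)) (pow_pos h0 3))
    (sub_pos.2 (betaLogMoment_mul_lt_sq ha hb hx))

theorem betaLogVariance_strictAntiOn (ha : 0 < a) (hb0 : 0 < b) (hb : b < 1) :
    StrictAntiOn (betaLogVariance a b) (Ioc 0 1) := by
  refine strictAntiOn_of_deriv_neg (convex_Ioc 0 1) (continuousOn_betaLogVariance ha hb0)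
    fun x hx => ?_
  rw [interior_Ioc] at hx
  rw [(hasDerivAt_betaLogVariance ha hb0 hx).deriv]
  have h0 := betaLogMoment_zero_pos hx.1 hx.2.le ha hb0
  exact mul_neg_of_pos_of_neg (div_pos (mul_pos two_pos (beta_density_pos hx)) (pow_pos h0 3))
    (sub_neg.2 (sq_lt_betaLogMoment_mul ha hb0 hb hx))

end Variance

/-! ### Second logarithmic derivative in `a`, and the theorem -/

section NormIncBeta

variable {x a b : ℝ}

theorem incBeta_eq_betaLogMoment (x a b : ℝ) : incBeta x a b = betaLogMoment 0 x a b := by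
  simp [incBeta, betaLogMoment]

theorem normIncBeta_pos (hx : x ∈ Ioo (0 : ℝ) 1) (ha : 0 < a) (hb : 0 < b) :
    0 < normIncBeta x a b := by
  rw [normIncBeta, incBeta_eq_betaLogMoment, incBeta_eq_betaLogMoment]
  exact div_pos (betaLogMoment_zero_pos hx.1 hx.2.le ha hb)
    (betaLogMoment_zero_pos one_pos le_rfl ha hb)

theorem log_normIncBeta (hx : x ∈ Ioo (0 : ℝ) 1) (ha : 0 < a) (hb : 0 < b) :
    Real.log (normIncBeta x a b) =
      Real.log (betaLogMoment 0 x a b) - Real.log (betaLogMoment 0 1 a b) := by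
  rw [normIncBeta, incBeta_eq_betaLogMoment, incBeta_eq_betaLogMoment,
    Real.log_div (betaLogMoment_zero_pos hx.1 hx.2.le ha hb).ne'
      (betaLogMoment_zero_pos one_pos le_rfl ha hb).ne']

theorem hasDerivAt_log_betaLogMoment (hx0 : 0 < x) (hx : x ≤ 1) (ha : 0 < a) (hb : 0 < b) :
    HasDerivAt (fun a => Real.log (betaLogMoment 0 x a b))
      (betaLogMoment 1 x a b / betaLogMoment 0 x a b) a :=
  (hasDerivAt_betaLogMoment_param hx0.le hx 0 ha hb).log
    (betaLogMoment_zero_pos hx0 hx ha hb).ne'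

theorem hasDerivAt_betaLogMoment_div (hx0 : 0 < x) (hx : x ≤ 1) (ha : 0 < a) (hb : 0 < b) :
    HasDerivAt (fun a => betaLogMoment 1 x a b / betaLogMoment 0 x a b)
      (betaLogVariance a b x) a := by
  have h0 := (betaLogMoment_zero_pos hx0 hx ha hb).ne'
  refine ((hasDerivAt_betaLogMoment_param hx0.le hx 1 ha hb).fun_div
    (hasDerivAt_betaLogMoment_param hx0.le hx 0 ha hb) h0).congr_deriv ?_
  simp only [betaLogVariance]
  field_simp

theorem hasDerivAt_log_normIncBeta (hx : x ∈ Ioo (0 : ℝ) 1) (ha : 0 < a) (hb : 0 < b) :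
    HasDerivAt (fun a => Real.log (normIncBeta x a b))
      (betaLogMoment 1 x a b / betaLogMoment 0 x a b -
        betaLogMoment 1 1 a b / betaLogMoment 0 1 a b) a := by
  refine ((hasDerivAt_log_betaLogMoment hx.1 hx.2.le ha hb).sub
    (hasDerivAt_log_betaLogMoment one_pos le_rfl ha hb)).congr_of_eventuallyEq ?_
  filter_upwards [Ioi_mem_nhds ha] with c hc
  exact log_normIncBeta hx hc hb

theorem deriv2_log_normIncBeta (hx : x ∈ Ioo (0 : ℝ) 1) (ha : 0 < a) (hb : 0 < b) :
    deriv^[2] (fun a => Real.log (normIncBeta x a b)) a =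
      betaLogVariance a b x - betaLogVariance a b 1 := by
  -- The formula for the first derivative is needed near `a`, not just at `a`, before
  -- differentiating again.
  have he : (deriv fun a => Real.log (normIncBeta x a b)) =ᶠ[𝓝 a] fun a =>
      betaLogMoment 1 x a b / betaLogMoment 0 x a b -
        betaLogMoment 1 1 a b / betaLogMoment 0 1 a b := by
    filter_upwards [Ioi_mem_nhds ha] with c hc
    exact (hasDerivAt_log_normIncBeta hx hc hb).deriv
  exact (((hasDerivAt_betaLogMoment_div hx.1 hx.2.le ha hb).sub
    (hasDerivAt_betaLogMoment_div one_pos le_rfl ha hb)).congr_of_eventuallyEq he).deriv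

theorem normIncBeta_one (x : ℝ) (ha : 0 < a) : normIncBeta x a 1 = x ^ a := by
  have h : ∀ y : ℝ, incBeta y a 1 = y ^ a / a := fun y => by
    simp only [incBeta, sub_self, Real.rpow_zero, mul_one]
    rw [integral_rpow (Or.inl (by linarith)), sub_add_cancel, Real.zero_rpow ha.ne', sub_zero]
  rw [normIncBeta, h, h, Real.one_rpow]
  field_simp

end NormIncBeta

end

theorem mainTheorem2 (x : ℝ) (hx : x ∈ Ioo (0 : ℝ) 1) :
    (∀ b : ℝ, 0 < b → b < 1 → StrictLogConvexOn (Ioi 0) (fun a => normIncBeta x a b)) ∧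
    ((∀ a : ℝ, 0 < a → normIncBeta x a 1 = x ^ a) ∧
      LogNeutralOn (Ioi 0) (fun a => normIncBeta x a 1)) ∧
    (∀ b : ℝ, 1 < b → StrictLogConcaveOn (Ioi 0) (fun a => normIncBeta x a b)) := by
  have hcont : ∀ b : ℝ, 0 < b →
      ContinuousOn (fun a => Real.log (normIncBeta x a b)) (Ioi 0) := fun b hb a ha =>
    (hasDerivAt_log_normIncBeta hx ha hb).continuousAt.continuousWithinAt
  have hx1 : x ∈ Ioc (0 : ℝ) 1 := ⟨hx.1, hx.2.le⟩
  have h11 : (1 : ℝ) ∈ Ioc (0 : ℝ) 1 := ⟨one_pos, le_rfl⟩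
  refine ⟨fun b hb0 hb => ⟨fun a ha => normIncBeta_pos hx ha hb0, ?_⟩,
    ⟨fun a ha => normIncBeta_one x ha, fun a ha => normIncBeta_pos hx ha one_pos, ?_⟩,
    fun b hb => ⟨fun a ha => normIncBeta_pos hx ha (by linarith), ?_⟩⟩
  · refine strictConvexOn_of_deriv2_pos' (convex_Ioi 0) (hcont b hb0) fun a ha => ?_
    rw [deriv2_log_normIncBeta hx ha hb0]
    exact sub_pos.2 (betaLogVariance_strictAntiOn ha hb0 hb hx1 h11 hx.2)
  · have hlog : EqOn (fun a : ℝ => a * Real.log x) (fun a => Real.log (normIncBeta x a 1))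
        (Ioi 0) := fun a ha => by
      simp only [normIncBeta_one x ha, Real.log_rpow hx.1]
    have hlin : IsLinearMap ℝ fun a : ℝ => a * Real.log x :=
      ⟨fun a c => add_mul a c _, fun a c => by simp [mul_assoc]⟩
    exact ⟨((hlin.mk' _).convexOn (convex_Ioi 0)).congr hlog,
      ((hlin.mk' _).concaveOn (convex_Ioi 0)).congr hlog⟩
  · refine strictConcaveOn_of_deriv2_neg' (convex_Ioi 0) (hcont b (by linarith)) fun a ha => ?_
    rw [deriv2_log_normIncBeta hx ha (by linarith)]
    exact sub_neg.2 (betaLogVariance_strictMonoOn ha hb hx1 h11 hx.2)
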